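/- **Timed words.** Let $\Sigma$ be any alphabet. A timed word is a finite sequence of pairs (letter in $\Sigma$, date in $\mathbb R_{\ge 0}$). For classes of models $\mathcal M_1,\mathcal M_2$ over $\Sigma$, write $\mathcal M_1\prec\mathcal M_2$ if every $X_1\in\mathcal M_1$ has some $X_2\in\mathcal M_2$ with $\mathcal L(X_1)=\mathcal L(X_2)$, and there is $X_2\in\mathcal M_2$ with $\mathcal L(X_2)\ne\mathcal L(X_1)$ for all $X_1\in\mathcal M_1$. **Timed automata.** A timed automaton has finitely many locations $\ell$ with invariants $\mathrm{Inv}(\ell)$, an initial location, a set of final locations, finitely many clocks, and finitely many edges $(\ell,g,\sigma,R,\ell')$ with guard $g$, letter $\sigma\in\Sigma$ (no silent letter) and set $R$ of clocks to reset. Constraints are finite conjunctions of atoms $a\le x$, $x\le b$, $a\le x-y$, $x-y\le b$ with rational constants. A run starts in the initial location with all clocks $0$ and is a finite sequence of timed moves (of duration $d\ge0$; the invariant must hold for all durations $d'\in[0,d]$) and discrete moves (the guard holds, and after the reset the invariant of $\ell'$ holds). Its timed word lists the letters of its edges, each dated by the total time elapsed before it. $\mathcal L$ is the set of timed words of runs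 that end in a final location. $TA(\le,\ge)$ is the class of timed automata whose guards are conjunctions of atoms $x\ge c$ and whose invariants are conjunctions of atoms $x\le c$. **Waiting nets.** A waiting net has finite disjoint sets $P$ of standard places and $C$ of control places, not both empty, a finite set $T$ of transitions, incidence functions ${}^\bullet t,\,t^\bullet\in\mathbb N^{P\cup C}$, bounds $\alpha(t)\in\mathbb Q_{\ge0}$ and $\beta(t)\in\mathbb Q_{\ge0}\cup\{\infty\}$ with $\alpha(t)\le\beta(t)$, labels $\lambda(t)\in\Sigma\cup\{\epsilon\}$, and an initial marking in $\mathbb N^{P\cup C}$. In a marking $m$, $t$ is *enabled* if $m\ge{}^\bullet t$ on $P$, *fully enabled* if $m\ge{}^\bullet t$ on $P\cup C$, and *waiting* if enabled but not fully enabled. A configuration is a marking with clock values $v(t)\in\mathbb R_{\ge0}\cup\{\bot\}$; initially $v(t)=0$ if $t$ is enabled and $v(t)=\bot$ otherwise. - A timed move of $d\ge0$ units requires $v(t)+d\le\beta(t)$ for every fully enabled $t$. It sets $v'(t)=v(t)+d$ for fully enabled $t$, $v'(t)=\min(\beta(t),v(t)+d)$ for waiting $t$, and $v'(t)=\bot$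 otherwise. - A discrete move fires a fully enabled $t$ with $\alpha(t)\le v(t)\le\beta(t)$, leading from $m$ to $m'=m-{}^\bullet t+t^\bullet$. The clock of $s$ becomes $0$ if $s$ is enabled in $m'$ and either $s=t$ or $s$ is not enabled in $m-{}^\bullet t$; it becomes $\bot$ if $s$ is not enabled in $m'$; otherwise it is unchanged. The timed language consists of the timed words of all finite runs from the initial configuration: labels of the fired transitions, dated by the elapsed time, with $\epsilon$ erased. A net is bounded if some integer bounds the number of tokens of each place in all reachable markings. $BWTPN$ is the class of bounded waiting nets with injective $\lambda$ and without label $\epsilon$. **Theorem.** For every alphabet $\Sigma$, $$BWTPN\prec TA(\le,\ge).$$ Moreover, for any two distinct letters $a,b\in\Sigma$, strictness is witnessed by the following automaton with one clock $x$ and three locations, all final: the initial location $s_0$ without invariant, $s_1$ with invariant $x\le3$ and $s_2$ with invariant $x\le5$, and the two edges $s_0\to s_1$ (letter $a$, guard $x\ge2$) and $s_0\to s_2$ (letter $b$, guard $x\ge4$), without resets. It belongs to $TA(\le,\ge)$, and no net in $BWTPN$ has its timed language. -/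

import Mathlib

/-! Timed words and languages, timed automata, waiting nets and their expressiveness. -/

/-- Finite timed words: letters paired with the dates at which they occur. -/
abbrev TimedWord (A : Type*) := List (A × NNReal)

/-! ### Comparing classes of models by their timed languages

A class of models is given by its type of models and the language function on it. -/

/-- Every model of the first class has a language-equivalent model in the second one. -/
def LessExpressive {M₁ M₂ A : Type*}
    (lang₁ : M₁ → Set (TimedWord A)) (lang₂ : M₂ → Set (TimedWord A)) : Prop :=
  ∀ X₁ : M₁, ∃ X₂ : M₂, lang₁ X₁ = lang₂ X₂

/-- The first class is included in the second one, and some model of the second one has a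
language that no model of the first one has. -/
def StrictlyLessExpressive {M₁ M₂ A : Type*}
    (lang₁ : M₁ → Set (TimedWord A)) (lang₂ : M₂ → Set (TimedWord A)) : Prop :=
  LessExpressive lang₁ lang₂ ∧ ∃ X₂ : M₂, ∀ X₁ : M₁, lang₂ X₂ ≠ lang₁ X₁

/-! ### Clock constraints -/

/-- Atomic constraints `a ≤ x`, `x ≤ b`, `a ≤ x - y`, `x - y ≤ b` with rational constants. -/
inductive AtomicConstraint (X : Type)
  | ge (x : X) (a : ℚ)
  | le (x : X) (b : ℚ)
  | diffGe (x y : X) (a : ℚ)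
  | diffLe (x y : X) (b : ℚ)

/-- Satisfaction of an atomic constraint by a valuation of the clocks. -/
def AtomicConstraint.Sat {X : Type} (v : X → NNReal) : AtomicConstraint X → Prop
  | .ge x a => (a : ℝ) ≤ (v x : ℝ)
  | .le x b => (v x : ℝ) ≤ (b : ℝ)
  | .diffGe x y a => (a : ℝ) ≤ (v x : ℝ) - (v y : ℝ)
  | .diffLe x y b => (v x : ℝ) - (v y : ℝ) ≤ (b : ℝ)

/-- The atomic constraint has the form `x ≥ c`. -/
def AtomicConstraint.IsGe {X : Type} (φ : AtomicConstraint X) : Prop :=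
  ∃ x c, φ = .ge x c

/-- The atomic constraint has the form `x ≤ c`. -/
def AtomicConstraint.IsLe {X : Type} (φ : AtomicConstraint X) : Prop :=
  ∃ x c, φ = .le x c

/-- A constraint is a (finite) conjunction of atomic constraints. -/
abbrev ClockConstraint (X : Type) := List (AtomicConstraint X)

/-- Satisfaction of a conjunction. -/
def ClockConstraint.Sat {X : Type} (v : X → NNReal) (φ : ClockConstraint X) : Prop :=
  ∀ ψ ∈ φ, ψ.Sat v

/-! ### Timed automata -/

/-- An edge `(ℓ, g, σ, R, ℓ')`. -/
structure TAEdge (Loc Clock : Type) (A : Type*) where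
  src : Loc
  guard : ClockConstraint Clock
  letter : A
  reset : Set Clock
  tgt : Loc

/-- Finite timed automata over the alphabet `A`, without silent transitions. -/
structure TimedAutomaton (A : Type*) where
  Loc : Type
  Clock : Type
  finite_loc : Finite Loc
  finite_clock : Finite Clock
  init : Loc
  inv : Loc → ClockConstraint Clock
  edges : Set (TAEdge Loc Clock A)
  finite_edges : edges.Finite
  final : Set Loc

namespace TimedAutomaton

variable {A : Type*} (𝒜 : TimedAutomaton A)

/-- Configurations: a location and a clock valuation. -/
abbrev Config := 𝒜.Loc × (𝒜.Clock → NNReal)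

/-- A timed move of `d` time units: the invariant holds all along. -/
def TimedMove (c : 𝒜.Config) (d : NNReal) (c' : 𝒜.Config) : Prop :=
  (∀ d' : NNReal, d' ≤ d → (𝒜.inv c.1).Sat (fun x => c.2 x + d')) ∧
    c' = (c.1, fun x => c.2 x + d)

open Classical in
/-- The valuation obtained by setting the clocks in `R` to zero. -/
noncomputable def resetClocks {X : Type} (R : Set X) (v : X → NNReal) : X → NNReal :=
  fun x => if x ∈ R then 0 else v x

/-- A discrete move via the edge `e`. -/
def DiscreteMove (c : 𝒜.Config) (e : TAEdge 𝒜.Loc 𝒜.Clock A) (c' : 𝒜.Config) : Prop :=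
  e ∈ 𝒜.edges ∧ c.1 = e.src ∧ e.guard.Sat c.2 ∧
    c' = (e.tgt, resetClocks e.reset c.2) ∧ (𝒜.inv c'.1).Sat c'.2

/-- `𝒜.Run w τ c`: some run from the initial configuration ends in `c`, has total duration `τ`
and timed word `w`, where every letter is dated by the time elapsed before its occurrence. -/
inductive Run : TimedWord A → NNReal → 𝒜.Config → Prop
  | start : Run [] 0 (𝒜.init, fun _ => 0)
  | delay {w τ c d c'} : Run w τ c → 𝒜.TimedMove c d c' → Run w (τ + d) c'
  | fire {w τ c e c'} : Run w τ c → 𝒜.DiscreteMove c e c' → Run (w ++ [(e.letter, τ)]) τ c'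

/-- The timed language: timed words of the runs that end in a final location. -/
def language : Set (TimedWord A) := {w | ∃ τ c, 𝒜.Run w τ c ∧ c.1 ∈ 𝒜.final}

/-- Guards are conjunctions of atoms `x ≥ c`, invariants are conjunctions of atoms `x ≤ c`. -/
def IsLeGe : Prop :=
  (∀ e ∈ 𝒜.edges, ∀ φ ∈ e.guard, φ.IsGe) ∧ (∀ ℓ, ∀ φ ∈ 𝒜.inv ℓ, φ.IsLe)

end TimedAutomaton

/-- The class `TA(≤,≥)` over the alphabet `A`. -/
def TALeGe (A : Type*) := {𝒜 : TimedAutomaton A // 𝒜.IsLeGe}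

/-- The language function of the class `TA(≤,≥)`. -/
def TALeGe.language {A : Type*} (𝒜 : TALeGe A) : Set (TimedWord A) := 𝒜.1.language

/-- The automaton with locations `s₀ = 0` (initial, no invariant), `s₁ = 1` (invariant `x ≤ 3`)
and `s₂ = 2` (invariant `x ≤ 5`), one clock `x`, and the edges `s₀ → s₁` (letter `a`, guard
`x ≥ 2`) and `s₀ → s₂` (letter `b`, guard `x ≥ 4`), without resets; all locations are final. -/
def skipAutomaton {A : Type*} (a b : A) : TimedAutomaton A where
  Loc := Fin 3
  Clock := Unit
  finite_loc := inferInstance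
  finite_clock := inferInstance
  init := 0
  inv := ![[], [.le () 3], [.le () 5]]
  edges := {⟨0, [.ge () 2], a, ∅, 1⟩, ⟨0, [.ge () 4], b, ∅, 2⟩}
  finite_edges := by simp
  final := Set.univ

/-! ### Waiting nets -/

/-- Waiting nets with labels in `A ∪ {ε}`; the label `none` is the silent label `ε`.
The standard places are `P`, the control places are `C`. -/
structure WaitingNet (A : Type*) where
  P : Type
  C : Type
  T : Type
  finite_P : Finite P
  finite_C : Finite C
  finite_T : Finite T
  nonempty_places : Nonempty (P ⊕ C)
  pre : T → P ⊕ C → ℕ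
  post : T → P ⊕ C → ℕ
  earliest : T → NNRat
  latest : T → WithTop NNRat
  earliest_le_latest : ∀ t, (earliest t : WithTop NNRat) ≤ latest t
  lab : T → Option A
  M₀ : P ⊕ C → ℕ

/-- `x ≤ β` for a bound `β` that may be infinite. -/
def LeBound (x : NNReal) (β : WithTop NNRat) : Prop := ∀ b : NNRat, β = b → x ≤ (b : NNReal)

/-- `min(β, x)` for a bound `β` that may be infinite. -/
noncomputable def minBound (β : WithTop NNRat) (x : NNReal) : NNReal :=
  (β.map (fun b : NNRat => min (b : NNReal) x)).untopD x

theorem minBound_top (x : NNReal) : minBound ⊤ x = x := rfl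

theorem minBound_coe (b : NNRat) (x : NNReal) : minBound b x = min (b : NNReal) x := rfl

namespace WaitingNet

variable {A : Type*} (W : WaitingNet A)

/-- Markings assign a number of tokens to every standard and every control place. -/
abbrev Marking := W.P ⊕ W.C → ℕ

/-- `t` is enabled: its standard preset is filled. -/
def Enabled (m : W.Marking) (t : W.T) : Prop := ∀ p : W.P, W.pre t (.inl p) ≤ m (.inl p)

/-- `t` is fully enabled: its standard and its control preset are filled. -/
def FullyEnabled (m : W.Marking) (t : W.T) : Prop := ∀ p, W.pre t p ≤ m p

/-- `t` is waiting: enabled, but not fully enabled. -/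
def Waiting (m : W.Marking) (t : W.T) : Prop := W.Enabled m t ∧ ¬ W.FullyEnabled m t

/-- The intermediate marking, when `t` has consumed its tokens (used for fully enabled `t`). -/
def consume (m : W.Marking) (t : W.T) : W.Marking := fun p => m p - W.pre t p

/-- The marking after the firing of `t`. -/
def fireMarking (m : W.Marking) (t : W.T) : W.Marking := fun p => W.consume m t p + W.post t p

/-- `s` is newly enabled by the firing of `t` from `m`: it is enabled afterwards, and it is not
enabled in the intermediate marking or it is a new occurrence of `t`. -/
def NewlyEnabled (m : W.Marking) (t s : W.T) : Prop :=
  W.Enabled (W.fireMarking m t) s ∧ (¬ W.Enabled (W.consume m t) s ∨ s = t)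

/-- Configurations: a marking, and a clock value for every transition (`⊥` is the undefined
value of the clocks of transitions that are not enabled). -/
abbrev Config := W.Marking × (W.T → WithBot NNReal)

open Classical in
/-- The initial configuration. -/
noncomputable def initConfig : W.Config :=
  (W.M₀, fun t => if W.Enabled W.M₀ t then ((0 : NNReal) : WithBot NNReal) else ⊥)

/-- A timed move of `d` time units. Clocks of waiting transitions grow up to their upper bound
and stop there; clocks of fully enabled transitions may not exceed theirs. -/
def TimedMove (c : W.Config) (d : NNReal) (c' : W.Config) : Prop :=
  c'.1 = c.1 ∧
  (∀ t, W.Waiting c.1 t → c'.2 t = WithBot.map (fun x => minBound (W.latest t) (x + d)) (c.2 t)) ∧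
  (∀ t, W.FullyEnabled c.1 t →
    (∀ x : NNReal, c.2 t = x → LeBound (x + d) (W.latest t)) ∧
      c'.2 t = WithBot.map (fun x => x + d) (c.2 t)) ∧
  (∀ t, ¬ W.Enabled c.1 t → c'.2 t = ⊥)

open Classical in
/-- The firing of the transition `t`. -/
def DiscreteMove (c : W.Config) (t : W.T) (c' : W.Config) : Prop :=
  W.FullyEnabled c.1 t ∧
  (∃ x : NNReal, c.2 t = x ∧ (W.earliest t : NNReal) ≤ x ∧ LeBound x (W.latest t)) ∧
  c'.1 = W.fireMarking c.1 t ∧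
  ∀ s, c'.2 s =
    if W.NewlyEnabled c.1 t s then ((0 : NNReal) : WithBot NNReal)
    else if ¬ W.Enabled c'.1 s then ⊥
    else c.2 s

/-- `W.Run u τ c`: some run from the initial configuration ends in `c`, has total duration `τ`
and fires the transitions in `u` at the dates in `u`. -/
inductive Run : TimedWord W.T → NNReal → W.Config → Prop
  | start : Run [] 0 W.initConfig
  | delay {u τ c d c'} : Run u τ c → W.TimedMove c d c' → Run u (τ + d) c'
  | fire {u τ c t c'} : Run u τ c → W.DiscreteMove c t c' → Run (u ++ [(t, τ)]) τ c'

/-- Replace transitions by their labels and erase the silent ones. -/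
def labelWord (u : TimedWord W.T) : TimedWord A :=
  u.filterMap (fun e => (W.lab e.1).map (fun a => (a, e.2)))

/-- The timed language: labelled timed words of all runs. -/
def language : Set (TimedWord A) := {w | ∃ u τ c, W.Run u τ c ∧ w = W.labelWord u}

/-- Some integer bounds the number of tokens of every place in every reachable marking. -/
def Bounded : Prop := ∃ K : ℕ, ∀ u τ c, W.Run u τ c → ∀ p, c.1 p ≤ K

/-- No transition has the silent label. -/
def EpsilonFree : Prop := ∀ t, W.lab t ≠ none

/-- Distinct transitions have distinct labels. -/
def InjectivelyLabelled : Prop := Function.Injective W.lab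

end WaitingNet

/-- The class of bounded waiting nets with injective labelling and without silent transitions,
over the alphabet `A`. -/
def BWTPN (A : Type*) :=
  {W : WaitingNet A // W.Bounded ∧ W.EpsilonFree ∧ W.InjectivelyLabelled}

/-- The language function of the class of bounded waiting nets. -/
def BWTPN.language {A : Type*} (W : BWTPN A) : Set (TimedWord A) := W.1.language

/-! Translation of bounded waiting nets into timed automata, and a separating automaton. -/

/-! The clock of an enabled transition equals min(β, x), where x is the time since it was enabled,
so untruncated clocks determine the net configuration (`timedMove_configOf`,
`discreteMove_configOf`). As α ≤ β, firing amounts to testing α ≤ x, an atom of the form ≥.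

The difficulty lies in deadlines: a transition that waited beyond β and then receives its control
tokens must block time, yet its automaton clock violates x ≤ β. Locations therefore carry, besides
the marking, a set E of expired transitions, guessed afresh at each edge. The guard checks x ≥ β on
E, so nothing is declared expired too early. The invariant requires x ≤ β for fully enabled
transitions outside E, so no expiry is missed. For fully enabled transitions in E with finite β it
requires z ≤ 0, where z is reset at every edge, which stops time. Boundedness makes the set of
locations finite. Delays match by `Consistent.delay_iff`, firings by `discreteMove_decode` and
`exists_isTAStep`.

For strictness, the marking is fixed until the first firing and a lower bound once met stays met.
Hence if a net can start with a at τ and with b at σ ≥ τ, it can start with a at σ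
(`singleton_mem_of_le`). `skipAutomaton` accepts (a,2) and (b,4) but not (a,4). Over alphabets
without two distinct letters another witness is needed: the empty language, since every net accepts
the empty word. -/

theorem coe_ratCast_nnrat (b : NNRat) : (((b : ℚ) : ℝ)) = ((b : NNReal) : ℝ) := by
  push_cast
  rfl

/-! ### Arithmetic of truncated clocks -/

theorem leBound_coe {x : NNReal} {b : NNRat} : LeBound x b ↔ x ≤ (b : NNReal) := by
  refine ⟨fun h => h b rfl, fun h b' hb => ?_⟩
  rw [WithTop.coe_inj] at hb
  exact hb ▸ h

theorem leBound_top (x : NNReal) : LeBound x ⊤ := fun _ hb => absurd hb WithTop.top_ne_coe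

theorem leBound_minBound (β : WithTop NNRat) (x : NNReal) : LeBound (minBound β x) β := by
  induction β with
  | top => exact leBound_top _
  | coe b => rw [leBound_coe, minBound_coe]; exact min_le_left _ _

theorem minBound_zero (β : WithTop NNRat) : minBound β 0 = 0 := by
  induction β with
  | top => rfl
  | coe b => rw [minBound_coe]; exact min_eq_right zero_le

/-- Truncating during each delay has the same effect as truncating once at the end; this is what
allows clocks to run on beyond β. -/
theorem minBound_minBound_add (β : WithTop NNRat) (x d : NNReal) :
    minBound β (minBound β x + d) = minBound β (x + d) := by
  induction β with
  | top => rfl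
  | coe b =>
    simp only [minBound_coe]
    rcases le_total (b : NNReal) x with h | h
    · rw [min_eq_left h, min_eq_left le_self_add, min_eq_left (h.trans le_self_add)]
    · rw [min_eq_right h]

theorem minBound_eq_self {β : WithTop NNRat} {x : NNReal} (h : LeBound x β) :
    minBound β x = x := by
  induction β with
  | top => rfl
  | coe b => rw [minBound_coe]; exact min_eq_right (leBound_coe.1 h)

/-- For a fully enabled transition no truncation occurs: if x already exceeds β, the hypothesis
forces d = 0. -/
theorem minBound_add_of_leBound {β : WithTop NNRat} {x d : NNReal}
    (h : LeBound (minBound β x + d) β) : minBound β (x + d) = minBound β x + d := by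
  rw [← minBound_minBound_add, minBound_eq_self h]

theorem le_minBound_iff {a : NNRat} {β : WithTop NNRat} (h : (a : WithTop NNRat) ≤ β)
    {x : NNReal} : (a : NNReal) ≤ minBound β x ↔ (a : NNReal) ≤ x := by
  induction β with
  | top => rfl
  | coe b =>
    have : (a : NNReal) ≤ b := by exact_mod_cast WithTop.coe_le_coe.1 h
    rw [minBound_coe, le_min_iff, and_iff_right this]

namespace WaitingNet

variable {A : Type*} (W : WaitingNet A)

theorem FullyEnabled.enabled {W : WaitingNet A} {m : W.Marking} {t : W.T}
    (h : W.FullyEnabled m t) : W.Enabled m t := fun p => h (.inl p)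

theorem newlyEnabled_of_not_enabled {W : WaitingNet A} {m : W.Marking} {t s : W.T}
    (h' : W.Enabled (W.fireMarking m t) s) (h : ¬ W.Enabled m s) : W.NewlyEnabled m t s :=
  ⟨h', .inl fun hc => h fun p => (hc p).trans (Nat.sub_le _ _)⟩

/-! ### Configurations determined by unbounded clocks -/

open Classical in
/-- The configuration with marking `m`, when `x s` is the time elapsed since `s` was enabled. -/
noncomputable def configOf (m : W.Marking) (x : W.T → NNReal) : W.Config :=
  (m, fun s => if W.Enabled m s then (minBound (W.latest s) (x s) : WithBot NNReal) else ⊥)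

theorem configOf_zero : W.configOf W.M₀ (fun _ => 0) = W.initConfig := by
  simp only [configOf, initConfig, minBound_zero]

theorem timedMove_configOf {m : W.Marking} {x : W.T → NNReal} {d : NNReal} {c : W.Config} :
    W.TimedMove (W.configOf m x) d c ↔
      (∀ s, W.FullyEnabled m s → LeBound (minBound (W.latest s) (x s) + d) (W.latest s)) ∧
        c = W.configOf m (fun s => x s + d) := by
  constructor
  · rintro ⟨h₁, h₂, h₃, h₄⟩
    have hfull : ∀ s, W.FullyEnabled m s →
        LeBound (minBound (W.latest s) (x s) + d) (W.latest s) :=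
      fun s hs => (h₃ s hs).1 _ (if_pos hs.enabled)
    refine ⟨hfull, Prod.ext h₁ (funext fun s => ?_)⟩
    by_cases he : W.Enabled m s
    · by_cases hf : W.FullyEnabled m s
      · rw [(h₃ s hf).2]
        simp only [configOf, if_pos he, WithBot.map_coe]
        rw [minBound_add_of_leBound (hfull s hf)]
      · rw [h₂ s ⟨he, hf⟩]
        simp only [configOf, if_pos he, WithBot.map_coe, minBound_minBound_add]
    · rw [h₄ s he]
      simp only [configOf, if_neg he]
  · rintro ⟨hfull, rfl⟩
    refine ⟨rfl, fun s hs => ?_, fun s hs => ⟨fun y hy => ?_, ?_⟩, fun s hs => if_neg hs⟩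
    · simp only [configOf] at hs ⊢
      simp only [if_pos hs.1, WithBot.map_coe, minBound_minBound_add]
    · simp only [configOf] at hs hy
      rw [if_pos hs.enabled, WithBot.coe_inj] at hy
      exact hy ▸ hfull s hs
    · simp only [configOf] at hs ⊢
      simp only [if_pos hs.enabled, WithBot.map_coe, minBound_add_of_leBound (hfull s hs)]

open Classical in
-- The upper bound imposes nothing, since a truncated clock never exceeds it. The values of `x` at
-- transitions that are not enabled are irrelevant: becoming enabled again resets them.
theorem discreteMove_configOf {m : W.Marking} {x : W.T → NNReal} {t : W.T} {c : W.Config} :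
    W.DiscreteMove (W.configOf m x) t c ↔
      W.FullyEnabled m t ∧ (W.earliest t : NNReal) ≤ x t ∧
        c = W.configOf (W.fireMarking m t)
          (TimedAutomaton.resetClocks {s | W.NewlyEnabled m t s} x) := by
  have hclock : ∀ s, (W.configOf (W.fireMarking m t)
      (TimedAutomaton.resetClocks {s | W.NewlyEnabled m t s} x)).2 s =
        if W.NewlyEnabled m t s then ((0 : NNReal) : WithBot NNReal)
        else if ¬ W.Enabled (W.fireMarking m t) s then ⊥ else (W.configOf m x).2 s := by
    intro s
    by_cases hn : W.NewlyEnabled m t s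
    · simp [configOf, TimedAutomaton.resetClocks, hn, hn.1, minBound_zero]
    · by_cases he' : W.Enabled (W.fireMarking m t) s
      · have he : W.Enabled m s := by
          by_contra he
          exact hn (newlyEnabled_of_not_enabled he' he)
        simp [configOf, TimedAutomaton.resetClocks, hn, he, he']
      · simp [configOf, he', hn]
  constructor
  · rintro ⟨hf, ⟨y, hy, hα, -⟩, h₁, h₂⟩
    refine ⟨hf, ?_, Prod.ext h₁ (funext fun s => ?_)⟩
    · have hy' : minBound (W.latest t) (x t) = y :=
        WithBot.coe_injective ((if_pos hf.enabled).symm.trans hy)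
      rwa [← hy', le_minBound_iff (W.earliest_le_latest t)] at hα
    · rw [h₂ s, hclock s, h₁]
      rfl
  · rintro ⟨hf, hα, rfl⟩
    exact ⟨hf, ⟨_, if_pos hf.enabled, (le_minBound_iff (W.earliest_le_latest t)).2 hα,
      leBound_minBound _ _⟩, rfl, hclock⟩

/-! ### The automaton of a bounded net -/

/-- Locations: a marking bounded by `K`, and a set of transitions whose clocks are known to have
reached their upper bounds. -/
abbrev TALoc (K : ℕ) : Type := {m : W.Marking // ∀ p, m p ≤ K} × Set W.T

theorem finite_taLoc (K : ℕ) : Finite (W.TALoc K) := by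
  have := W.finite_P
  have := W.finite_C
  have := W.finite_T
  have : Finite {m : W.Marking // ∀ p, m p ≤ K} :=
    Finite.of_injective (β := W.P ⊕ W.C → Fin (K + 1))
      (fun m p => ⟨m.1 p, Nat.lt_succ_of_le (m.2 p)⟩)
      fun m m' h => Subtype.ext <| funext fun p => Fin.val_eq_of_eq (congrFun h p)
  infer_instance

theorem finite_boundAtoms (S : Set W.T) (f : W.T → NNRat → AtomicConstraint (Option W.T)) :
    {φ | ∃ s ∈ S, ∃ b : NNRat, W.latest s = b ∧ φ = f s b}.Finite := by
  have := W.finite_T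
  -- The default 0 for an infinite bound only adds superfluous atoms to the finite superset.
  refine (S.toFinite.image fun s => f s ((W.latest s).untopD 0)).subset ?_
  rintro _ ⟨s, hs, b, hb, rfl⟩
  exact ⟨s, hs, by simp only [hb, WithTop.untopD_coe]⟩

/-- The conjunction of the atoms `f s b`, for the transitions `s` in `S` with finite upper
bound `b`. -/
noncomputable def boundAtoms (S : Set W.T) (f : W.T → NNRat → AtomicConstraint (Option W.T)) :
    ClockConstraint (Option W.T) := (W.finite_boundAtoms S f).toFinset.toList

theorem mem_boundAtoms {S : Set W.T} {f : W.T → NNRat → AtomicConstraint (Option W.T)}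
    {φ : AtomicConstraint (Option W.T)} :
    φ ∈ W.boundAtoms S f ↔ ∃ s ∈ S, ∃ b : NNRat, W.latest s = b ∧ φ = f s b := by
  simp [boundAtoms]

theorem sat_boundAtoms {S : Set W.T} {f : W.T → NNRat → AtomicConstraint (Option W.T)}
    {v : Option W.T → NNReal} :
    (W.boundAtoms S f).Sat v ↔ ∀ s ∈ S, ∀ b : NNRat, W.latest s = b → (f s b).Sat v := by
  simp only [ClockConstraint.Sat, mem_boundAtoms]
  constructor
  · exact fun h s hs b hb => h _ ⟨s, hs, b, hb, rfl⟩
  · rintro h _ ⟨s, hs, b, hb, rfl⟩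
    exact h s hs b hb

/-- The invariant of a location: no time elapses if a fully enabled transition has reached its
upper bound; clocks of the other fully enabled transitions respect their upper bounds. -/
noncomputable def taInv {K : ℕ} (ℓ : W.TALoc K) : ClockConstraint (Option W.T) :=
  W.boundAtoms ({s | W.FullyEnabled ℓ.1.1 s} ∩ ℓ.2) (fun _ _ => .le none 0) ++
    W.boundAtoms ({s | W.FullyEnabled ℓ.1.1 s} \ ℓ.2) (fun s b => .le (some s) b)

/-- The guard of the edges for `t` towards locations with set of expired transitions `E`. -/
noncomputable def taGuard (t : W.T) (E : Set W.T) : ClockConstraint (Option W.T) :=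
  .ge (some t) (W.earliest t) :: W.boundAtoms E (fun s b => .ge (some s) b)

theorem sat_taInv {K : ℕ} {ℓ : W.TALoc K} {v : Option W.T → NNReal} :
    (W.taInv ℓ).Sat v ↔ ∀ s, W.FullyEnabled ℓ.1.1 s → ∀ b : NNRat, W.latest s = b →
      (s ∈ ℓ.2 → v none = 0) ∧ (s ∉ ℓ.2 → v (some s) ≤ (b : NNReal)) := by
  have hsplit : (W.taInv ℓ).Sat v ↔
      (W.boundAtoms ({s | W.FullyEnabled ℓ.1.1 s} ∩ ℓ.2) (fun _ _ => .le none 0)).Sat v ∧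
        (W.boundAtoms ({s | W.FullyEnabled ℓ.1.1 s} \ ℓ.2) (fun s b => .le (some s) b)).Sat v :=
    List.forall_mem_append
  have hz : ((v none : ℝ) ≤ ((0 : ℚ) : ℝ)) ↔ v none = 0 := by
    rw [Rat.cast_zero, ← NNReal.coe_zero, NNReal.coe_le_coe, nonpos_iff_eq_zero]
  rw [hsplit, sat_boundAtoms, sat_boundAtoms]
  simp only [AtomicConstraint.Sat, coe_ratCast_nnrat, NNReal.coe_le_coe, hz]
  constructor
  · exact fun h s hs b hb => ⟨fun hE => h.1 s ⟨hs, hE⟩ b hb, fun hE => h.2 s ⟨hs, hE⟩ b hb⟩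
  · exact fun h => ⟨fun s hs b hb => (h s hs.1 b hb).1 hs.2, fun s hs b hb => (h s hs.1 b hb).2 hs.2⟩

theorem sat_taGuard {t : W.T} {E : Set W.T} {v : Option W.T → NNReal} :
    (W.taGuard t E).Sat v ↔ (W.earliest t : NNReal) ≤ v (some t) ∧
      ∀ s ∈ E, ∀ b : NNRat, W.latest s = b → (b : NNReal) ≤ v (some s) := by
  have h := W.sat_boundAtoms (S := E) (f := fun s b => .ge (some s) b) (v := v)
  simp only [ClockConstraint.Sat, AtomicConstraint.Sat, coe_ratCast_nnrat, NNReal.coe_le_coe] at h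
  simp only [ClockConstraint.Sat, taGuard, List.forall_mem_cons, h, AtomicConstraint.Sat,
    coe_ratCast_nnrat, NNReal.coe_le_coe]

/-- The clocks reset by the firing of `t`. -/
def taReset (m : W.Marking) (t : W.T) : Set (Option W.T) :=
  insert none (some '' {s | W.NewlyEnabled m t s})

theorem resetClocks_taReset_none {m : W.Marking} {t : W.T} {v : Option W.T → NNReal} :
    TimedAutomaton.resetClocks (W.taReset m t) v none = 0 := by
  simp [TimedAutomaton.resetClocks, taReset]

theorem resetClocks_taReset_some {m : W.Marking} {t s : W.T} {v : Option W.T → NNReal} :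
    TimedAutomaton.resetClocks (W.taReset m t) v (some s) =
      TimedAutomaton.resetClocks {s | W.NewlyEnabled m t s} (fun s => v (some s)) s := by
  have h : some s ∈ W.taReset m t ↔ s ∈ {s | W.NewlyEnabled m t s} := by
    simp [taReset]
  unfold TimedAutomaton.resetClocks
  by_cases hs : s ∈ {s | W.NewlyEnabled m t s}
  · rw [if_pos hs, if_pos (h.2 hs)]
  · rw [if_neg hs, if_neg (mt h.1 hs)]

/-- The edge for the firing of `t` between two locations. -/
noncomputable def taEdge {K : ℕ} (letter : W.T → A) (x : W.TALoc K × W.T × W.TALoc K) :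
    TAEdge (W.TALoc K) (Option W.T) A :=
  ⟨x.1, W.taGuard x.2.1 x.2.2.2, letter x.2.1, W.taReset x.1.1.1 x.2.1, x.2.2⟩

/-- The edge relation of the automaton. Clocks of newly enabled transitions are not expired. -/
def IsTAStep {K : ℕ} (x : W.TALoc K × W.T × W.TALoc K) : Prop :=
  W.FullyEnabled x.1.1.1 x.2.1 ∧ x.2.2.1.1 = W.fireMarking x.1.1.1 x.2.1 ∧
    ∀ s ∈ x.2.2.2, ¬ W.NewlyEnabled x.1.1.1 x.2.1 s

/-- The timed automaton of a net whose reachable markings are bounded by `K`. The clock `none`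
measures the time elapsed since the last discrete move. -/
noncomputable abbrev toTA (K : ℕ) (hK : ∀ p, W.M₀ p ≤ K) (letter : W.T → A) : TimedAutomaton A where
  Loc := W.TALoc K
  Clock := Option W.T
  finite_loc := W.finite_taLoc K
  finite_clock := have := W.finite_T; inferInstance
  init := (⟨W.M₀, hK⟩, ∅)
  inv := W.taInv
  edges := W.taEdge letter '' {x | W.IsTAStep x}
  finite_edges :=
    have := W.finite_T
    have := W.finite_taLoc K
    (Set.toFinite _).image _
  final := Set.univ

variable {K : ℕ} {hK : ∀ p, W.M₀ p ≤ K} {letter : W.T → A}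

theorem toTA_isLeGe : (W.toTA K hK letter).IsLeGe := by
  constructor
  · rintro _ ⟨x, -, rfl⟩ φ hφ
    rcases List.mem_cons.1 hφ with rfl | hφ
    · exact ⟨_, _, rfl⟩
    · obtain ⟨s, -, b, -, rfl⟩ := W.mem_boundAtoms.1 hφ
      exact ⟨_, _, rfl⟩
  · intro ℓ φ hφ
    rcases List.mem_append.1 hφ with hφ | hφ
    all_goals
      obtain ⟨s, -, b, -, rfl⟩ := W.mem_boundAtoms.1 hφ
      exact ⟨_, _, rfl⟩

/-! ### The bisimulation -/

/-- The configurations of the automaton in which the invariant holds and the clocks of the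
transitions marked as expired have reached their upper bounds. -/
def Consistent (ℓ : W.TALoc K) (v : Option W.T → NNReal) : Prop :=
  (W.taInv ℓ).Sat v ∧
    ∀ s ∈ ℓ.2, W.FullyEnabled ℓ.1.1 s → ∀ b : NNRat, W.latest s = b → (b : NNReal) ≤ v (some s)

/-- The net configuration represented by a configuration of the automaton. -/
noncomputable def decode (ℓ : W.TALoc K) (v : Option W.T → NNReal) : W.Config :=
  W.configOf ℓ.1.1 (fun s => v (some s))

theorem consistent_init : W.Consistent ((⟨W.M₀, hK⟩, ∅) : W.TALoc K) (fun _ => 0) :=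
  ⟨W.sat_taInv.2 fun _ _ _ _ => ⟨fun h => h.elim, fun _ => zero_le⟩, fun _ h => h.elim⟩

variable {W}

/-- For an expired transition with finite bound both sides say d = 0; for any other fully enabled
one with finite bound, the current clock is at most β, so truncation is invisible. -/
theorem Consistent.delay_iff {ℓ : W.TALoc K} {v : Option W.T → NNReal} (h : W.Consistent ℓ v)
    {d : NNReal} : (∀ d' ≤ d, (W.taInv ℓ).Sat (fun x => v x + d')) ↔
      ∀ s, W.FullyEnabled ℓ.1.1 s →
        LeBound (minBound (W.latest s) (v (some s)) + d) (W.latest s) := by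
  have h₁ := W.sat_taInv.1 h.1
  simp only [sat_taInv]
  constructor
  · intro H s hs b hb
    rw [hb, minBound_coe]
    by_cases hE : s ∈ ℓ.2
    · have := (H d le_rfl s hs b hb).1 hE
      rw [(add_eq_zero.1 this).2, add_zero]
      exact min_le_left _ _
    · exact (add_le_add_left (min_le_right _ _) _).trans ((H d le_rfl s hs b hb).2 hE)
  · intro H d' hd' s hs b hb
    have hd := H s hs b hb
    rw [hb, minBound_coe] at hd
    refine ⟨fun hE => ?_, fun hE => ?_⟩
    · rw [min_eq_left (h.2 s hE hs b hb)] at hd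
      have hd0 : d = 0 := by simpa using hd
      rw [(h₁ s hs b hb).1 hE, zero_add]
      exact le_antisymm (hd'.trans_eq hd0) zero_le
    · rw [min_eq_right ((h₁ s hs b hb).2 hE)] at hd
      exact (add_le_add_right hd' _).trans hd

theorem Consistent.delay {ℓ : W.TALoc K} {v : Option W.T → NNReal} (h : W.Consistent ℓ v)
    {d : NNReal} (hd : (W.taInv ℓ).Sat (fun x => v x + d)) :
    W.Consistent ℓ (fun x => v x + d) :=
  ⟨hd, fun s hE hs b hb => (h.2 s hE hs b hb).trans le_self_add⟩

theorem Consistent.timedMove_iff {ℓ : W.TALoc K} {v : Option W.T → NNReal}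
    (h : W.Consistent ℓ v) {d : NNReal} {c : W.Config} :
    W.TimedMove (W.decode ℓ v) d c ↔
      (W.toTA K hK letter).TimedMove (ℓ, v) d (ℓ, fun x => v x + d) ∧
        c = W.decode ℓ (fun x => v x + d) := by
  rw [decode, timedMove_configOf, ← h.delay_iff]
  exact and_congr_left fun _ => ⟨fun h => ⟨h, rfl⟩, fun h => h.1⟩

theorem decode_resetClocks {ℓ ℓ' : W.TALoc K} {t : W.T} {v : Option W.T → NNReal}
    (h : ℓ'.1.1 = W.fireMarking ℓ.1.1 t) :
    W.decode ℓ' (TimedAutomaton.resetClocks (W.taReset ℓ.1.1 t) v) =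
      W.configOf (W.fireMarking ℓ.1.1 t)
        (TimedAutomaton.resetClocks {s | W.NewlyEnabled ℓ.1.1 t s} fun s => v (some s)) := by
  simp only [decode, h, resetClocks_taReset_some]

/-- The guard tests the clocks before the reset, but the reset spares the transitions of the
target's expired set. -/
theorem Consistent.fire {ℓ ℓ' : W.TALoc K} {t : W.T} {v : Option W.T → NNReal}
    (hstep : W.IsTAStep (ℓ, t, ℓ')) (hg : (W.taGuard t ℓ'.2).Sat v)
    (hinv : (W.taInv ℓ').Sat (TimedAutomaton.resetClocks (W.taReset ℓ.1.1 t) v)) :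
    W.Consistent ℓ' (TimedAutomaton.resetClocks (W.taReset ℓ.1.1 t) v) := by
  refine ⟨hinv, fun s hs _ b hb => ?_⟩
  have hn : s ∉ {s | W.NewlyEnabled ℓ.1.1 t s} := hstep.2.2 s hs
  rw [resetClocks_taReset_some, TimedAutomaton.resetClocks, if_neg hn]
  exact (W.sat_taGuard.1 hg).2 s hs b hb

theorem discreteMove_decode {ℓ ℓ' : W.TALoc K} {t : W.T} {v : Option W.T → NNReal}
    (hstep : W.IsTAStep (ℓ, t, ℓ')) (hg : (W.taGuard t ℓ'.2).Sat v) :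
    W.DiscreteMove (W.decode ℓ v) t
      (W.decode ℓ' (TimedAutomaton.resetClocks (W.taReset ℓ.1.1 t) v)) := by
  rw [decode_resetClocks hstep.2.1]
  exact W.discreteMove_configOf.2 ⟨hstep.1, (W.sat_taGuard.1 hg).1, rfl⟩

theorem exists_isTAStep {ℓ : W.TALoc K} {t : W.T} {v : Option W.T → NNReal} {c : W.Config}
    (h : W.DiscreteMove (W.decode ℓ v) t c) (hc : ∀ p, c.1 p ≤ K) :
    ∃ ℓ' : W.TALoc K, W.IsTAStep (ℓ, t, ℓ') ∧ (W.taGuard t ℓ'.2).Sat v ∧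
      (W.taInv ℓ').Sat (TimedAutomaton.resetClocks (W.taReset ℓ.1.1 t) v) ∧
      c = W.decode ℓ' (TimedAutomaton.resetClocks (W.taReset ℓ.1.1 t) v) := by
  obtain ⟨hf, hα, rfl⟩ := W.discreteMove_configOf.1 h
  -- The expired set is chosen as large as possible. Its members meet the invariant because the
  -- clock `none` was just reset; a transition left out was reset or has not reached its finite
  -- bound.
  refine ⟨(⟨W.fireMarking ℓ.1.1 t, hc⟩, {s | ¬ W.NewlyEnabled ℓ.1.1 t s ∧
    ∀ b : NNRat, W.latest s = b → (b : NNReal) ≤ v (some s)}),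
    ⟨hf, rfl, fun s hs => hs.1⟩, W.sat_taGuard.2 ⟨hα, fun s hs => hs.2⟩,
    W.sat_taInv.2 fun s _ b hb => ⟨fun _ => resetClocks_taReset_none W, fun hs => ?_⟩,
    (decode_resetClocks rfl).symm⟩
  rw [resetClocks_taReset_some, TimedAutomaton.resetClocks]
  split_ifs with hn
  · exact zero_le
  · by_contra hlt
    refine hs ⟨hn, fun b' hb' => ?_⟩
    rw [hb, WithTop.coe_inj] at hb'
    exact hb' ▸ (not_le.1 hlt).le

theorem labelWord_append_singleton (hlab : ∀ t, W.lab t = some (letter t)) (u : TimedWord W.T)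
    (t : W.T) (τ : NNReal) :
    W.labelWord (u ++ [(t, τ)]) = W.labelWord u ++ [(letter t, τ)] := by
  simp [labelWord, hlab]

theorem run_of_run_toTA (hlab : ∀ t, W.lab t = some (letter t)) {w : TimedWord A}
    {τ : NNReal} {q : (W.toTA K hK letter).Config} (h : (W.toTA K hK letter).Run w τ q) :
    W.Consistent q.1 q.2 ∧ ∃ u, W.Run u τ (W.decode q.1 q.2) ∧ w = W.labelWord u := by
  induction h with
  | start =>
    refine ⟨W.consistent_init, [], ?_, rfl⟩
    have : W.Run [] 0 W.initConfig := .start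
    rwa [← configOf_zero] at this
  | @delay w τ q d q' _ hd ih =>
    obtain ⟨hq, u, hu, rfl⟩ := ih
    obtain ⟨hinv, rfl⟩ := hd
    exact ⟨hq.delay (hinv d le_rfl), u,
      hu.delay (hq.timedMove_iff.2 ⟨⟨hinv, rfl⟩, rfl⟩), rfl⟩
  | @fire w τ q e q' _ he ih =>
    obtain ⟨hq, u, hu, rfl⟩ := ih
    obtain ⟨⟨⟨ℓ, t, ℓ'⟩, hstep, rfl⟩, hsrc, hg, rfl, hinv⟩ := he
    obtain ⟨ℓ₀, v⟩ := q
    obtain rfl : ℓ₀ = ℓ := hsrc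
    exact ⟨.fire hstep hg hinv, u ++ [(t, τ)], hu.fire (discreteMove_decode hstep hg),
      (labelWord_append_singleton hlab u t τ).symm⟩

/-- Only existence is claimed: a net configuration does not determine the expired set or the clocks
beyond their bounds. -/
theorem run_toTA_of_run (hlab : ∀ t, W.lab t = some (letter t))
    (hbd : ∀ u τ c, W.Run u τ c → ∀ p, c.1 p ≤ K) {u : TimedWord W.T} {τ : NNReal}
    {c : W.Config} (h : W.Run u τ c) :
    ∃ (ℓ : W.TALoc K) (v : Option W.T → NNReal), W.Consistent ℓ v ∧ c = W.decode ℓ v ∧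
      (W.toTA K hK letter).Run (W.labelWord u) τ (ℓ, v) := by
  induction h with
  | start => exact ⟨(⟨W.M₀, hK⟩, ∅), fun _ => 0, W.consistent_init, W.configOf_zero.symm, .start⟩
  | @delay u τ c d c' _ hd ih =>
    obtain ⟨ℓ, v, hq, rfl, hr⟩ := ih
    obtain ⟨hmove, rfl⟩ := (hq.timedMove_iff (hK := hK) (letter := letter)).1 hd
    exact ⟨ℓ, _, hq.delay (hmove.1 d le_rfl), rfl, hr.delay hmove⟩
  | @fire u τ c t c' hu ht ih =>
    obtain ⟨ℓ, v, hq, rfl, hr⟩ := ih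
    obtain ⟨ℓ', hstep, hg, hinv, rfl⟩ := exists_isTAStep ht (hbd _ _ _ (hu.fire ht))
    refine ⟨ℓ', _, .fire hstep hg hinv, rfl, ?_⟩
    rw [labelWord_append_singleton hlab]
    have hmem : W.taEdge letter (ℓ, t, ℓ') ∈ (W.toTA K hK letter).edges :=
      Set.mem_image_of_mem _ hstep
    have hmove : (W.toTA K hK letter).DiscreteMove (ℓ, v) (W.taEdge letter (ℓ, t, ℓ'))
        (ℓ', TimedAutomaton.resetClocks (W.taReset ℓ.1.1 t) v) := ⟨hmem, rfl, hg, rfl, hinv⟩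
    exact hr.fire hmove

theorem language_toTA (hlab : ∀ t, W.lab t = some (letter t))
    (hbd : ∀ u τ c, W.Run u τ c → ∀ p, c.1 p ≤ K) :
    W.language = (W.toTA K hK letter).language := by
  ext w
  constructor
  · rintro ⟨u, τ, c, hr, rfl⟩
    obtain ⟨ℓ, v, -, -, hr'⟩ := run_toTA_of_run (hK := hK) hlab hbd hr
    exact ⟨τ, _, hr', trivial⟩
  · rintro ⟨τ, q, hr, -⟩
    obtain ⟨-, u, hu, rfl⟩ := run_of_run_toTA hlab hr
    exact ⟨u, τ, _, hu, rfl⟩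

/-! ### First letters of a net -/

/-- Before the first firing, all clocks measure the elapsed time. -/
theorem eq_configOf_of_run_nil {u : TimedWord W.T} {τ : NNReal} {c : W.Config}
    (h : W.Run u τ c) (hu : u = []) : c = W.configOf W.M₀ (fun _ => τ) := by
  induction h with
  | start => exact W.configOf_zero.symm
  | delay _ hd ih =>
    obtain rfl := ih hu
    exact (W.timedMove_configOf.1 hd).2
  | fire => simp at hu

theorem discreteMove_of_run_singleton {t : W.T} {τ τ' : NNReal} {c : W.Config}
    {u : TimedWord W.T} (h : W.Run u τ' c) (hu : u = [(t, τ)]) :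
    ∃ c₀ c₁, W.Run [] τ c₀ ∧ W.DiscreteMove c₀ t c₁ := by
  induction h with
  | start => simp at hu
  | delay _ _ ih => exact ih hu
  | @fire u τ c t' c' hr ht _ =>
    -- The last firing is the only one, so the run before it fires nothing.
    obtain ⟨rfl, h⟩ := List.append_inj' (s₂ := []) hu rfl
    obtain ⟨rfl, rfl⟩ : t' = t ∧ _ = _ := by simpa using h
    exact ⟨_, _, hr, ht⟩

/-- Without silent labels `labelWord` preserves length, so no hidden firing precedes the letter. -/
theorem exists_run_of_singleton_mem (he : W.EpsilonFree) {a : A} {τ : NNReal}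
    (h : [(a, τ)] ∈ W.language) :
    ∃ t c₀ c₁, W.lab t = some a ∧ W.Run [] τ c₀ ∧ W.DiscreteMove c₀ t c₁ := by
  obtain ⟨u, τ', c, hr, hw⟩ := h
  have hlen : ∀ u : TimedWord W.T, (W.labelWord u).length = u.length := by
    intro u
    induction u with
    | nil => rfl
    | cons e u ih =>
      obtain ⟨a', ha'⟩ := Option.ne_none_iff_exists'.1 (he e.1)
      simp only [labelWord] at ih
      simp [labelWord, ha', ih]
  obtain ⟨⟨t, σ⟩, rfl⟩ := List.length_eq_one_iff.1
    ((hlen u).symm.trans (congrArg List.length hw).symm)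
  obtain ⟨a', ha'⟩ := Option.ne_none_iff_exists'.1 (he t)
  obtain ⟨rfl, rfl⟩ : a = a' ∧ τ = σ := by simpa [labelWord, ha'] using hw
  obtain ⟨c₀, c₁, h₀, h₁⟩ := discreteMove_of_run_singleton hr rfl
  exact ⟨t, c₀, c₁, ha', h₀, h₁⟩

/-- A first letter can be delayed until another letter is the first one. -/
theorem singleton_mem_of_le (he : W.EpsilonFree) {a b : A} {τ σ : NNReal} (hle : τ ≤ σ)
    (ha : [(a, τ)] ∈ W.language) (hb : [(b, σ)] ∈ W.language) : [(a, σ)] ∈ W.language := by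
  obtain ⟨t, c₀, c₁, hlab, hr, ht⟩ := exists_run_of_singleton_mem he ha
  -- The word of `b` serves only to show that time can reach `σ` without any firing.
  obtain ⟨-, c, -, -, hr', -⟩ := exists_run_of_singleton_mem he hb
  obtain rfl := eq_configOf_of_run_nil hr rfl
  obtain rfl := eq_configOf_of_run_nil hr' rfl
  obtain ⟨hf, hα, -⟩ := W.discreteMove_configOf.1 ht
  exact ⟨[(t, σ)], σ, _, hr'.fire (W.discreteMove_configOf.2 ⟨hf, hα.trans hle, rfl⟩),
    by simp [labelWord, hlab]⟩

end WaitingNet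

/-! ### The separating automaton -/

section skipAutomaton

variable {A : Type*} {a b : A}

theorem skipAutomaton_isLeGe (a b : A) : (skipAutomaton a b).IsLeGe := by
  constructor
  · rintro e (rfl | rfl) φ hφ
    all_goals
      obtain rfl := List.mem_singleton.1 hφ
      exact ⟨_, _, rfl⟩
  · intro ℓ φ hφ
    obtain rfl | rfl | rfl : ℓ = (0 : Fin 3) ∨ ℓ = (1 : Fin 3) ∨ ℓ = (2 : Fin 3) := by
      have h : ∀ i : Fin 3, i = 0 ∨ i = 1 ∨ i = 2 := by decide
      exact h ℓ
    · exact absurd hφ List.not_mem_nil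
    all_goals
      obtain rfl := List.mem_singleton.1 hφ
      exact ⟨_, _, rfl⟩

theorem skipAutomaton_run_init (a b : A) (τ : NNReal) :
    (skipAutomaton a b).Run [] τ ((0 : Fin 3), fun _ => τ) := by
  have h : (skipAutomaton a b).Run [] (0 + τ) ((0 : Fin 3), fun _ => 0 + τ) :=
    .delay .start ⟨fun d' _ ψ hψ => absurd hψ List.not_mem_nil, rfl⟩
  simpa using h

theorem resetClocks_empty {X : Type} (v : X → NNReal) :
    TimedAutomaton.resetClocks ∅ v = v := by
  funext x
  simp [TimedAutomaton.resetClocks]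

theorem fst_mem_skipAutomaton_language (a b : A) :
    [(a, (2 : NNReal))] ∈ (skipAutomaton a b).language := by
  have hmove : (skipAutomaton a b).DiscreteMove ((0 : Fin 3), fun _ => 2)
      (⟨0, [.ge () 2], a, ∅, 1⟩ : TAEdge (Fin 3) Unit A) ((1 : Fin 3), fun _ => 2) := by
    refine ⟨.inl rfl, rfl, fun ψ hψ => ?_, ?_, fun ψ hψ => ?_⟩
    · obtain rfl := List.mem_singleton.1 hψ
      change ((2 : ℚ) : ℝ) ≤ ((2 : NNReal) : ℝ)
      norm_num
    · exact congrArg (Prod.mk _) (resetClocks_empty _).symm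
    · obtain rfl := List.mem_singleton.1 hψ
      change ((2 : NNReal) : ℝ) ≤ ((3 : ℚ) : ℝ)
      norm_num
  exact ⟨2, _, (skipAutomaton_run_init a b 2).fire hmove, trivial⟩

theorem snd_mem_skipAutomaton_language (a b : A) :
    [(b, (4 : NNReal))] ∈ (skipAutomaton a b).language := by
  have hmove : (skipAutomaton a b).DiscreteMove ((0 : Fin 3), fun _ => 4)
      (⟨0, [.ge () 4], b, ∅, 2⟩ : TAEdge (Fin 3) Unit A) ((2 : Fin 3), fun _ => 4) := by
    refine ⟨.inr rfl, rfl, fun ψ hψ => ?_, ?_, fun ψ hψ => ?_⟩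
    · obtain rfl := List.mem_singleton.1 hψ
      change ((4 : ℚ) : ℝ) ≤ ((4 : NNReal) : ℝ)
      norm_num
    · exact congrArg (Prod.mk _) (resetClocks_empty _).symm
    · obtain rfl := List.mem_singleton.1 hψ
      change ((4 : NNReal) : ℝ) ≤ ((5 : ℚ) : ℝ)
      norm_num
  exact ⟨4, _, (skipAutomaton_run_init a b 4).fire hmove, trivial⟩

/-- The clock is never reset, so it shows the date; the edge for `a` enters a location with
invariant x ≤ 3. -/
theorem skipAutomaton_run_invariant {w : TimedWord A} {τ : NNReal}
    {q : (skipAutomaton a b).Config} (h : (skipAutomaton a b).Run w τ q) :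
    (∀ x, q.2 x = τ) ∧ ∀ p ∈ w, p.1 = b ∨ p.2 ≤ 3 := by
  induction h with
  | start => simp
  | delay _ hd ih =>
    obtain ⟨-, rfl⟩ := hd
    exact ⟨fun x => by simp [ih.1 x], ih.2⟩
  | @fire w τ q e q' _ he ih =>
    obtain ⟨he, -, -, rfl, hinv⟩ := he
    have hreset : TimedAutomaton.resetClocks e.reset q.2 = q.2 := by
      rcases he with rfl | rfl <;> exact resetClocks_empty _
    simp only [hreset] at hinv ⊢
    refine ⟨ih.1, fun p hp => (List.mem_append.1 hp).elim (ih.2 p) fun hp => ?_⟩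
    obtain rfl := List.mem_singleton.1 hp
    rcases he with rfl | rfl
    · have h3 : (q.2 () : ℝ) ≤ ((3 : ℚ) : ℝ) := hinv _ (List.mem_singleton_self _)
      have hτ : q.2 () = τ := ih.1 ()
      rw [hτ] at h3
      exact .inr (by exact_mod_cast h3)
    · exact .inl rfl

theorem skipAutomaton_language_ne (hab : a ≠ b) (W : BWTPN A) :
    (skipAutomaton a b).language ≠ W.language := by
  intro h
  have h4 : [(a, (4 : NNReal))] ∈ (skipAutomaton a b).language := by
    have ha := fst_mem_skipAutomaton_language a b
    have hb := snd_mem_skipAutomaton_language a b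
    rw [h] at ha hb ⊢
    exact WaitingNet.singleton_mem_of_le W.2.2.1 (by norm_num) ha hb
  obtain ⟨τ, q, hr, -⟩ := h4
  rcases (skipAutomaton_run_invariant hr).2 _ (List.mem_singleton_self _) with h | h
  · exact hab h
  · norm_num at h

end skipAutomaton

/-! ### Inclusion, and strictness over an arbitrary alphabet -/

/-- The automaton without final locations, whose language is empty. -/
def emptyAutomaton (A : Type*) : TimedAutomaton A where
  Loc := Unit
  Clock := Unit
  finite_loc := inferInstance
  finite_clock := inferInstance
  init := ()
  inv := fun _ => []
  edges := ∅
  finite_edges := Set.finite_empty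
  final := ∅

theorem emptyAutomaton_isLeGe (A : Type*) : (emptyAutomaton A).IsLeGe :=
  ⟨fun _ h => h.elim, fun _ _ h => absurd h List.not_mem_nil⟩

/-- All runs of a net count, including the one without moves, so its language contains the empty
word. -/
theorem emptyAutomaton_language_ne {A : Type*} (W : BWTPN A) :
    (emptyAutomaton A).language ≠ W.language := by
  intro h
  have hmem : [] ∈ (emptyAutomaton A).language := h ▸ ⟨[], 0, _, .start, rfl⟩
  obtain ⟨_, _, _, hf⟩ := hmem
  exact hf

theorem lessExpressive_BWTPN_TALeGe {A : Type*} :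
    LessExpressive (BWTPN.language (A := A)) (TALeGe.language (A := A)) := by
  rintro ⟨W, ⟨K, hbd⟩, he, -⟩
  choose letter hlab using fun t => Option.ne_none_iff_exists'.1 (he t)
  exact ⟨⟨W.toTA K (hbd _ _ _ .start) letter, W.toTA_isLeGe⟩,
    WaitingNet.language_toTA hlab hbd⟩

/-- Bounded waiting nets are strictly less expressive than timed automata with guards `x ≥ c` and
invariants `x ≤ c`. Strictness is moreover witnessed by the automaton `skipAutomaton a b`, all of
whose locations are final, over any two distinct letters. -/
theorem mainTheorem6 {A : Type*} :
    StrictlyLessExpressive (BWTPN.language (A := A)) (TALeGe.language (A := A)) ∧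
    ∀ a b : A, a ≠ b →
      (skipAutomaton a b).IsLeGe ∧
      ∀ W : BWTPN A, (skipAutomaton a b).language ≠ W.language :=
  ⟨⟨lessExpressive_BWTPN_TALeGe, ⟨emptyAutomaton A, emptyAutomaton_isLeGe A⟩,
    emptyAutomaton_language_ne⟩,
    fun a b hab => ⟨skipAutomaton_isLeGe a b, skipAutomaton_language_ne hab⟩⟩
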